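/- An ultragraph $\mathcal{G} = (G^0, \mathcal{G}^1, r, s)$ consists of a countable set $G^0$ of vertices, a countable set $\mathcal{G}^1$ of edges, a source map $s : \mathcal{G}^1 \to G^0$ and a range map $r : \mathcal{G}^1 \to \mathcal{P}(G^0)\setminus\{\varnothing\}$. Let $\mathcal{G}^0$ be the smallest family of subsets of $G^0$ that contains $\varnothing$, all $\{v\}$ ($v\in G^0$) and all $r(e)$ ($e\in\mathcal{G}^1$), and is closed under relative complements, finite unions and finite intersections. A finite path is either an element $A\in\mathcal{G}^0$ (a path of length $0$, with $s(A)=r(A)=A$), or a sequence $\alpha=\alpha_1\cdots\alpha_n$ ($n\ge 1$) of edges with $s(\alpha_{i+1})\in r(\alpha_i)$ for $1\le i<n$, in which case $s(\alpha)=s(\alpha_1)$ and $r(\alpha)=r(\alpha_n)$. For $v,w\in G^0$ write $v\ge w$ if there is a finite path $p$ with $s(p)=v$ and $w\in r(p)$ (where $v$ is identified with $\{v\}$, so that $v\ge v$ always). The ultragraph $\mathcal{G}$ is downward directed if for any two $v,w\in G^0$ there is $u\in G^0$ with $v\ge u$ and $w\ge u$. For a field $K$, the Leavitt path algebra $L_K(\mathcal{G})$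 is the (associative, not necessarily unital) $K$-algebra generated by $\{s_e, s_e^*\mid e\in\mathcal{G}^1\}\cup\{p_A\mid A\in\mathcal{G}^0\}$ subject to the following relations, for all $A,B\in\mathcal{G}^0$ and $e,f\in\mathcal{G}^1$, with $p_v := p_{\{v\}}$: (1) $p_\varnothing=0$, $p_Ap_B=p_{A\cap B}$, $p_{A\cup B}=p_A+p_B-p_{A\cap B}$; (2) $p_{s(e)}s_e=s_e=s_ep_{r(e)}$ and $p_{r(e)}s_e^*=s_e^*=s_e^*p_{s(e)}$; (3) $s_e^*s_f=\delta_{e,f}\,p_{r(e)}$; (4) $p_v=\sum_{s(e)=v}s_es_e^*$ for every vertex $v$ with $0<|s^{-1}(v)|<\infty$. A (not necessarily unital) ring $R$ is called prime if $IJ\neq 0$ for any two nonzero two-sided ideals $I,J$ of $R$. **Theorem.** Let $\mathcal{G}$ be an ultragraph and $K$ a field. Then $L_K(\mathcal{G})$ is a prime ring if and only if $\mathcal{G}$ is downward directed. -/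

import Mathlib

universe u v w

/-- An ultragraph with vertex set `V` and edge set `E`: every edge has a source vertex and a
nonempty set of vertices as its range.  (Countability of `V` and `E` is imposed through
`[Countable V] [Countable E]`.) -/
structure Ultragraph (V : Type u) (E : Type v) where
  /-- the source map -/
  s : E → V
  /-- the range map -/
  r : E → Set V
  r_nonempty : ∀ e, (r e).Nonempty

namespace Ultragraph

section Basic

variable {V : Type u} {E : Type v}

/-- Membership in `𝒢⁰`, the smallest family of sets of vertices that contains the singletons and the
ranges of edges and is closed under relative complements, finite unions (including the empty one)
and finite intersections. -/
inductive IsGeneralizedVertex (G : Ultragraph V E) : Set V → Prop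
  | singleton (v : V) : IsGeneralizedVertex G {v}
  | range (e : E) : IsGeneralizedVertex G (G.r e)
  | empty : IsGeneralizedVertex G ∅
  | diff {A B : Set V} : IsGeneralizedVertex G A → IsGeneralizedVertex G B →
      IsGeneralizedVertex G (A \ B)
  | union {A B : Set V} : IsGeneralizedVertex G A → IsGeneralizedVertex G B →
      IsGeneralizedVertex G (A ∪ B)
  | inter {A B : Set V} : IsGeneralizedVertex G A → IsGeneralizedVertex G B →
      IsGeneralizedVertex G (A ∩ B)

/-- The set `𝒢⁰` of generalized vertices, as a type. -/
def GeneralizedVertex (G : Ultragraph V E) : Type u :=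
  {A : Set V // G.IsGeneralizedVertex A}

/-- A finite path: a generalized vertex (a path of length `0`), or a nonempty sequence of edges
in which the source of each edge lies in the range of the preceding one. -/
inductive FinitePath (G : Ultragraph V E) : Type (max u v)
  | vertex (A : G.GeneralizedVertex) : FinitePath G
  | edges (l : List E) (hne : l ≠ []) (hl : l.IsChain (fun e f => G.s f ∈ G.r e)) : FinitePath G

/-- The source of a finite path, a vertex `v` being identified with the set `{v}`. -/
def FinitePath.source {G : Ultragraph V E} : G.FinitePath → Set V
  | .vertex A => A.1
  | .edges l hne _ => {G.s (l.head hne)}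

/-- The range of a finite path. -/
def FinitePath.range {G : Ultragraph V E} : G.FinitePath → Set V
  | .vertex A => A.1
  | .edges l hne _ => G.r (l.getLast hne)

/-- `v ≥ w`: there is a finite path with source `v` whose range contains `w`. -/
def Reaches (G : Ultragraph V E) (v w : V) : Prop :=
  ∃ p : G.FinitePath, p.source = {v} ∧ w ∈ p.range

/-- Any two vertices reach a common vertex. -/
def DownwardDirected (G : Ultragraph V E) : Prop :=
  ∀ v w : V, ∃ u : V, G.Reaches v u ∧ G.Reaches w u

/-- A regular vertex: it emits at least one edge, and only finitely many. -/
def IsRegular (G : Ultragraph V E) (v : V) : Prop :=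
  {e | G.s e = v}.Nonempty ∧ {e | G.s e = v}.Finite

/-- The generators `p_A`, `s_e`, `s_e^*` of the Leavitt path algebra. -/
inductive LeavittGenerator (G : Ultragraph V E) : Type (max u v)
  | proj (A : G.GeneralizedVertex) : LeavittGenerator G
  | edge (e : E) : LeavittGenerator G
  | ghost (e : E) : LeavittGenerator G

end Basic

noncomputable section Leavitt

variable (K : Type w) [Field K] {V : Type u} {E : Type v} (G : Ultragraph V E)

/-- The free (associative, not necessarily unital) `K`-algebra on the generators: its basis is the
set of nonempty words in the generators. -/
abbrev FreeLeavitt : Type (max u v w) := MonoidAlgebra K (FreeSemigroup G.LeavittGenerator)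

variable {G}

namespace FreeLeavitt

/-- A generator, as an element of the free algebra. -/
def of (x : G.LeavittGenerator) : FreeLeavitt K G :=
  MonoidAlgebra.single (FreeSemigroup.of x) 1

/-- The generator `p_A`, for a set `A` that is a generalized vertex. -/
def p (A : Set V) (hA : G.IsGeneralizedVertex A) : FreeLeavitt K G := of K (.proj ⟨A, hA⟩)

/-- The generator `s_e`. -/
def sEdge (e : E) : FreeLeavitt K G := of K (.edge e)

/-- The generator `s_e^*`. -/
def sStar (e : E) : FreeLeavitt K G := of K (.ghost e)

end FreeLeavitt

variable (G)

open FreeLeavitt IsGeneralizedVertex in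
/-- The defining relations of the Leavitt path algebra. -/
inductive LeavittRel : FreeLeavitt K G → FreeLeavitt K G → Prop
  | proj_empty : LeavittRel (p K ∅ empty) 0
  | proj_mul {A B : Set V} (hA : G.IsGeneralizedVertex A) (hB : G.IsGeneralizedVertex B) :
      LeavittRel (p K A hA * p K B hB) (p K (A ∩ B) (hA.inter hB))
  | proj_union {A B : Set V} (hA : G.IsGeneralizedVertex A) (hB : G.IsGeneralizedVertex B) :
      LeavittRel (p K (A ∪ B) (hA.union hB))
        (p K A hA + p K B hB - p K (A ∩ B) (hA.inter hB))
  | source_mul_edge (e : E) : LeavittRel (p K {G.s e} (singleton _) * sEdge K e) (sEdge K e)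
  | edge_mul_range (e : E) : LeavittRel (sEdge K e * p K (G.r e) (range e)) (sEdge K e)
  | range_mul_ghost (e : E) : LeavittRel (p K (G.r e) (range e) * sStar K e) (sStar K e)
  | ghost_mul_source (e : E) : LeavittRel (sStar K e * p K {G.s e} (singleton _)) (sStar K e)
  | ghost_mul_edge_self (e : E) : LeavittRel (sStar K e * sEdge K e) (p K (G.r e) (range e))
  | ghost_mul_edge_of_ne (e f : E) (hef : e ≠ f) : LeavittRel (sStar K e * sEdge K f) 0
  | regular (v : V) (hv : G.IsRegular v) :
      LeavittRel (p K {v} (singleton v)) (∑ e ∈ hv.2.toFinset, sEdge K e * sStar K e)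

/-- The `K`-algebra congruence generated by the defining relations.  Without a unit, a ring
congruence need not respect scalars, so all scalar multiples of the relations are imposed. -/
def leavittCon : RingCon (FreeLeavitt K G) :=
  ringConGen fun a b => ∃ (k : K) (x y : FreeLeavitt K G),
    LeavittRel K G x y ∧ a = k • x ∧ b = k • y

variable {K G} in
theorem leavittCon_smul (k : K) {a b : FreeLeavitt K G} (h : leavittCon K G a b) :
    leavittCon K G (k • a) (k • b) := by
  induction h with
  | of a b h =>
    obtain ⟨l, x, y, hxy, rfl, rfl⟩ := h
    exact RingConGen.Rel.of _ _ ⟨k * l, x, y, hxy, by rw [mul_smul], by rw [mul_smul]⟩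
  | refl a => exact (leavittCon K G).refl _
  | symm _ ih => exact (leavittCon K G).symm ih
  | trans _ _ ih₁ ih₂ => exact (leavittCon K G).trans ih₁ ih₂
  | add _ _ ih₁ ih₂ =>
    rw [smul_add, smul_add]
    exact (leavittCon K G).add ih₁ ih₂
  | mul _ hb ih₁ _ =>
    rw [← smul_mul_assoc, ← smul_mul_assoc]
    exact (leavittCon K G).mul ih₁ hb

/-- The Leavitt path algebra `L_K(𝒢)`: the (not necessarily unital) `K`-algebra presented by the
generators `p_A`, `s_e`, `s_e^*` and the relations `LeavittRel`. -/
def LeavittPathAlgebra : Type (max u v w) := (leavittCon K G).Quotient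

namespace LeavittPathAlgebra

instance : NonUnitalRing (LeavittPathAlgebra K G) :=
  inferInstanceAs (NonUnitalRing (leavittCon K G).Quotient)

/-- The quotient map from the free algebra. -/
def mk (a : FreeLeavitt K G) : LeavittPathAlgebra K G := (a : (leavittCon K G).Quotient)

variable {K G} in
theorem mk_surjective : Function.Surjective (mk K G) := Quotient.mk_surjective

instance : SMul K (LeavittPathAlgebra K G) :=
  ⟨fun k => Quotient.map (k • ·) fun _ _ h => leavittCon_smul k h⟩

instance : Module K (LeavittPathAlgebra K G) :=
  Function.Surjective.module K
    (⟨⟨mk K G, rfl⟩, fun _ _ => rfl⟩ : FreeLeavitt K G →+ LeavittPathAlgebra K G)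
    mk_surjective fun _ _ => rfl

instance : IsScalarTower K (LeavittPathAlgebra K G) (LeavittPathAlgebra K G) where
  smul_assoc k x y := by
    obtain ⟨a, rfl⟩ := mk_surjective x
    obtain ⟨b, rfl⟩ := mk_surjective y
    exact congrArg (mk K G) (smul_mul_assoc k a b)

instance : SMulCommClass K (LeavittPathAlgebra K G) (LeavittPathAlgebra K G) where
  smul_comm k x y := by
    obtain ⟨a, rfl⟩ := mk_surjective x
    obtain ⟨b, rfl⟩ := mk_surjective y
    exact congrArg (mk K G) (mul_smul_comm k a b).symm

end LeavittPathAlgebra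

end Leavitt

end Ultragraph

/-- A (not necessarily unital) ring is prime if the product of any two nonzero two-sided ideals is
nonzero, that is, if `I J = 0` implies `I = 0` or `J = 0`. -/
def IsPrimeRing (R : Type u) [NonUnitalRing R] : Prop :=
  ∀ I J : TwoSidedIdeal R, (∀ x ∈ I, ∀ y ∈ J, x * y = 0) → I = ⊥ ∨ J = ⊥

/-! Write `L` for the Leavitt path algebra. It is spanned by the monomials `s_α p_A s_β^*`, because
every product of generators collapses to one of these or to zero (`span_isMonomial`). A nonzero
monomial between `p_v` and `p_w` forces `v` and `w` to reach a common vertex. So if they reach none,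
then `p_v L p_w = 0`, although both projections are nonzero, and `L` is not prime.

The nonvanishing of `p_A` for nonempty `A` needs a model. `L` acts on functions on `V × ℕ`, edges
acting through injections of `r(e) × ℕ` into `{s(e)} × ℕ` whose images partition the fibre
(`exists_branchingSystem`, `p_ne_zero`).

For the converse, let `I J = 0` with nonzero `x ∈ I` and `y ∈ J`, so that `x L y = 0`. Giving edges
degree `1` and ghost edges degree `-1` makes `L` a ℤ-graded algebra, and comparing top-degree
coefficients passes the relation to nonzero homogeneous leading components
(`exists_homogeneous_of_mul_mul_eq_zero`). These components need not lie in `I` and `J`; only `x' L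
y' = 0` is used.

The heart is `exists_mul_mul_eq_p`: a nonzero homogeneous `x` satisfies `a x b = p_v` for some `a`,
`b`, `v`. Ghost edges are removed by right multiplication with edges. If all these products vanish,
the Cuntz–Krieger relation kills `x` at regular vertices, and what remains is a real part plus ghost
terms at infinite emitters, which can be avoided. Real paths of equal length are then stripped from
the left, down to a combination of projections, which is cut down to a single vertex.

Finally, if `x'` and `y'` are carried to `p_v` and `p_w`, and both vertices reach `u`, then both are
carried to `p_u`, and `p_u = p_u p_u ∈ L x' L y' L = 0`, a contradiction. -/

namespace Ultragraph

namespace LeavittPathAlgebra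

/-! ### Generators and relations in the quotient -/

noncomputable section Generators

variable (K : Type w) [Field K] {V : Type u} {E : Type v} (G : Ultragraph V E)

/-- The element `p_A` of the Leavitt path algebra. -/
def p {A : Set V} (hA : G.IsGeneralizedVertex A) : G.LeavittPathAlgebra K :=
  mk K G (FreeLeavitt.p K A hA)

/-- The element `s_e` of the Leavitt path algebra. -/
def s (e : E) : G.LeavittPathAlgebra K := mk K G (FreeLeavitt.sEdge K e)

/-- The element `s_e^*` of the Leavitt path algebra. -/
def t (e : E) : G.LeavittPathAlgebra K := mk K G (FreeLeavitt.sStar K e)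

/-- The quotient map as an additive homomorphism. -/
def mkHom : FreeLeavitt K G →+ G.LeavittPathAlgebra K := ⟨⟨mk K G, rfl⟩, fun _ _ => rfl⟩

variable {G}

theorem mk_mul (a b : FreeLeavitt K G) : mk K G (a * b) = mk K G a * mk K G b := rfl

theorem mk_smul (k : K) (a : FreeLeavitt K G) : mk K G (k • a) = k • mk K G a := rfl

theorem mk_eq_of_rel {a b : FreeLeavitt K G} (h : LeavittRel K G a b) :
    mk K G a = mk K G b :=
  Quotient.sound (RingConGen.Rel.of _ _ ⟨1, a, b, h, (one_smul _ _).symm, (one_smul _ _).symm⟩)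

variable {K}

theorem p_empty : p K G .empty = 0 :=
  mk_eq_of_rel K .proj_empty

theorem p_mul_p {A B : Set V} (hA : G.IsGeneralizedVertex A) (hB : G.IsGeneralizedVertex B) :
    p K G hA * p K G hB = p K G (hA.inter hB) :=
  mk_eq_of_rel K (.proj_mul hA hB)

theorem p_union {A B : Set V} (hA : G.IsGeneralizedVertex A) (hB : G.IsGeneralizedVertex B) :
    p K G (hA.union hB) = p K G hA + p K G hB - p K G (hA.inter hB) :=
  (mk_eq_of_rel K (.proj_union hA hB)).trans (map_sub (mkHom K G) _ _)

theorem p_source_mul_s (e : E) : p K G (.singleton (G.s e)) * s K G e = s K G e :=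
  mk_eq_of_rel K (.source_mul_edge e)

theorem s_mul_p_range (e : E) : s K G e * p K G (.range e) = s K G e :=
  mk_eq_of_rel K (.edge_mul_range e)

theorem p_range_mul_t (e : E) : p K G (.range e) * t K G e = t K G e :=
  mk_eq_of_rel K (.range_mul_ghost e)

theorem t_mul_p_source (e : E) : t K G e * p K G (.singleton (G.s e)) = t K G e :=
  mk_eq_of_rel K (.ghost_mul_source e)

theorem t_mul_s_self (e : E) : t K G e * s K G e = p K G (.range e) :=
  mk_eq_of_rel K (.ghost_mul_edge_self e)

theorem t_mul_s_of_ne {e f : E} (h : e ≠ f) : t K G e * s K G f = (0) :=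
  mk_eq_of_rel K (.ghost_mul_edge_of_ne e f h)

theorem p_regular {v : V} (hv : G.IsRegular v) :
    p K G (.singleton v) = ∑ e ∈ hv.2.toFinset, s K G e * t K G e :=
  (mk_eq_of_rel K (.regular v hv)).trans (map_sum (mkHom K G) _ _)

theorem p_congr {A B : Set V} (hA : G.IsGeneralizedVertex A) (h : A = B) :
    p K G hA = p K G (h ▸ hA : G.IsGeneralizedVertex B) := by
  subst h; rfl

theorem p_eq_zero_of_eq_empty {A : Set V} (hA : G.IsGeneralizedVertex A) (h : A = ∅) :
    p K G hA = 0 := by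
  subst h; exact p_empty

theorem p_mul_p_of_subset {A B : Set V} (hA : G.IsGeneralizedVertex A)
    (hB : G.IsGeneralizedVertex B) (h : B ⊆ A) : p K G hA * p K G hB = p K G hB := by
  rw [p_mul_p, p_congr _ (Set.inter_eq_right.mpr h)]

theorem p_mul_p_comm {A B : Set V} (hA : G.IsGeneralizedVertex A)
    (hB : G.IsGeneralizedVertex B) : p K G hA * p K G hB = p K G hB * p K G hA := by
  rw [p_mul_p, p_mul_p, p_congr _ (Set.inter_comm A B)]

theorem p_mul_p_of_disjoint {A B : Set V} (hA : G.IsGeneralizedVertex A)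
    (hB : G.IsGeneralizedVertex B) (h : A ∩ B = ∅) : p K G hA * p K G hB = 0 := by
  rw [p_mul_p, p_eq_zero_of_eq_empty _ h]

open Classical in
theorem p_singleton_mul_p (v : V) {A : Set V} (hA : G.IsGeneralizedVertex A) :
    p K G (.singleton v) * p K G hA = if v ∈ A then p K G (.singleton v) else 0 := by
  split_ifs with h
  · rw [p_mul_p_comm, p_mul_p_of_subset _ _ (by simpa using h)]
  · exact p_mul_p_of_disjoint _ _ (by simpa using h)

open Classical in
theorem p_mul_s {A : Set V} (hA : G.IsGeneralizedVertex A) (e : E) :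
    p K G hA * s K G e = if G.s e ∈ A then s K G e else 0 := by
  rw [← p_source_mul_s, ← mul_assoc, p_mul_p_comm, p_singleton_mul_p]
  split_ifs <;> simp

open Classical in
theorem t_mul_p {A : Set V} (hA : G.IsGeneralizedVertex A) (e : E) :
    t K G e * p K G hA = if G.s e ∈ A then t K G e else 0 := by
  rw [← t_mul_p_source, mul_assoc, p_singleton_mul_p]
  split_ifs <;> simp

open Classical in
theorem t_mul_s (e f : E) :
    t K G e * s K G f = if e = f then p K G (.range e) else 0 := by
  split_ifs with h
  · subst h; exact t_mul_s_self e
  · exact t_mul_s_of_ne h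

end Generators

/-! ### The universal property -/

noncomputable section Lift

variable {K : Type w} [Field K] {V : Type u} {E : Type v} {G : Ultragraph V E}
variable {A : Type*} [NonUnitalRing A] [Module K A] [IsScalarTower K A A] [SMulCommClass K A A]

/-- The homomorphism out of the Leavitt path algebra induced by a homomorphism of the free algebra
that respects the defining relations. -/
def lift (f : FreeLeavitt K G →ₙₐ[K] A) (hf : ∀ x y, LeavittRel K G x y → f x = f y) :
    G.LeavittPathAlgebra K →ₙₐ[K] A :=
  have key : ∀ x y, leavittCon K G x y → f x = f y := by
    intro x y h
    induction h with
    | of a b h =>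
      obtain ⟨k, x, y, hxy, rfl, rfl⟩ := h
      rw [map_smul, map_smul, hf _ _ hxy]
    | refl a => rfl
    | symm _ ih => exact ih.symm
    | trans _ _ ih₁ ih₂ => exact ih₁.trans ih₂
    | add _ _ ih₁ ih₂ => rw [map_add, map_add, ih₁, ih₂]
    | mul _ _ ih₁ ih₂ => rw [map_mul, map_mul, ih₁, ih₂]
  { toFun := Quotient.lift f key
    map_smul' := by rintro k ⟨x⟩; exact map_smul f k x
    map_zero' := map_zero f
    map_add' := by rintro ⟨x⟩ ⟨y⟩; exact map_add f x y
    map_mul' := by rintro ⟨x⟩ ⟨y⟩; exact map_mul f x y }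

/-- The homomorphism from the free algebra with prescribed values on the generators. -/
def freeLift (φ : G.LeavittGenerator → A) : FreeLeavitt K G →ₙₐ[K] A :=
  MonoidAlgebra.liftMagma K (FreeSemigroup.lift φ)

theorem freeLift_of (φ : G.LeavittGenerator → A) (x : G.LeavittGenerator) :
    freeLift (K := K) φ (FreeLeavitt.of K x) = φ x := by
  simp [freeLift, FreeLeavitt.of]

/-- A Leavitt family in an algebra: elements that satisfy the defining relations. -/
structure Family (G : Ultragraph V E) (A : Type*) [NonUnitalRing A] where
  /-- the image of a generator -/
  toFun : G.LeavittGenerator → A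
  empty : toFun (.proj ⟨∅, .empty⟩) = 0
  mul {B C : Set V} (hB : G.IsGeneralizedVertex B) (hC : G.IsGeneralizedVertex C) :
    toFun (.proj ⟨B, hB⟩) * toFun (.proj ⟨C, hC⟩) = toFun (.proj ⟨B ∩ C, hB.inter hC⟩)
  union {B C : Set V} (hB : G.IsGeneralizedVertex B) (hC : G.IsGeneralizedVertex C) :
    toFun (.proj ⟨B ∪ C, hB.union hC⟩) =
      toFun (.proj ⟨B, hB⟩) + toFun (.proj ⟨C, hC⟩) - toFun (.proj ⟨B ∩ C, hB.inter hC⟩)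
  source_mul_edge (e : E) :
    toFun (.proj ⟨{G.s e}, .singleton _⟩) * toFun (.edge e) = toFun (.edge e)
  edge_mul_range (e : E) : toFun (.edge e) * toFun (.proj ⟨_, .range e⟩) = toFun (.edge e)
  range_mul_ghost (e : E) : toFun (.proj ⟨_, .range e⟩) * toFun (.ghost e) = toFun (.ghost e)
  ghost_mul_source (e : E) :
    toFun (.ghost e) * toFun (.proj ⟨{G.s e}, .singleton _⟩) = toFun (.ghost e)
  ghost_mul_edge_self (e : E) :
    toFun (.ghost e) * toFun (.edge e) = toFun (.proj ⟨_, .range e⟩)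
  ghost_mul_edge_of_ne (e f : E) (h : e ≠ f) : toFun (.ghost e) * toFun (.edge f) = 0
  regular (v : V) (hv : G.IsRegular v) : toFun (.proj ⟨{v}, .singleton v⟩) =
    ∑ e ∈ hv.2.toFinset, toFun (.edge e) * toFun (.ghost e)

/-- The universal property of the Leavitt path algebra. -/
def Family.hom (φ : Family G A) : G.LeavittPathAlgebra K →ₙₐ[K] A :=
  lift (freeLift φ.toFun) fun x y h => by
    cases h with
    | proj_empty => simpa [FreeLeavitt.p, freeLift_of] using φ.empty
    | proj_mul hA hB => simpa [FreeLeavitt.p, freeLift_of] using φ.mul hA hB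
    | proj_union hA hB =>
      rw [map_sub, map_add]
      simpa only [FreeLeavitt.p, freeLift_of] using φ.union hA hB
    | source_mul_edge e =>
      simpa [FreeLeavitt.p, FreeLeavitt.sEdge, freeLift_of] using φ.source_mul_edge e
    | edge_mul_range e =>
      simpa [FreeLeavitt.p, FreeLeavitt.sEdge, freeLift_of] using φ.edge_mul_range e
    | range_mul_ghost e =>
      simpa [FreeLeavitt.p, FreeLeavitt.sStar, freeLift_of] using φ.range_mul_ghost e
    | ghost_mul_source e =>
      simpa [FreeLeavitt.p, FreeLeavitt.sStar, freeLift_of] using φ.ghost_mul_source e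
    | ghost_mul_edge_self e =>
      simpa [FreeLeavitt.p, FreeLeavitt.sStar, FreeLeavitt.sEdge, freeLift_of]
        using φ.ghost_mul_edge_self e
    | ghost_mul_edge_of_ne e f h =>
      simpa [FreeLeavitt.sStar, FreeLeavitt.sEdge, freeLift_of] using φ.ghost_mul_edge_of_ne e f h
    | regular v hv =>
      rw [map_sum]
      simpa only [FreeLeavitt.p, FreeLeavitt.sStar, FreeLeavitt.sEdge, freeLift_of, map_mul]
        using φ.regular v hv

theorem Family.hom_p (φ : Family G A) {B : Set V} (hB : G.IsGeneralizedVertex B) :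
    φ.hom (p K G hB) = φ.toFun (.proj ⟨B, hB⟩) :=
  freeLift_of (K := K) _ _

theorem Family.hom_s (φ : Family G A) (e : E) : φ.hom (s K G e) = φ.toFun (.edge e) :=
  freeLift_of (K := K) _ _

theorem Family.hom_t (φ : Family G A) (e : E) : φ.hom (t K G e) = φ.toFun (.ghost e) :=
  freeLift_of (K := K) _ _

end Lift

/-! ### A representation on functions on `V × ℕ`, and nonvanishing of projections -/

noncomputable section Representation

variable {V : Type u} {E : Type v} (G : Ultragraph V E)

/-- A branching system on `V × ℕ`: injections `σ e` of `r(e) × ℕ` into `{s(e)} × ℕ` whose ranges, for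
the edges with a given source `v`, partition `{v} × ℕ` if there are such edges.  The map `back` sends
a point in the range of `σ e` to `e` and its preimage. -/
structure BranchingSystem where
  /-- the injections -/
  σ : E → V × ℕ → V × ℕ
  /-- the partial inverse -/
  back : V × ℕ → Option (E × (V × ℕ))
  back_σ : ∀ e y, y.1 ∈ G.r e → back (σ e y) = some (e, y)
  of_back : ∀ x e y, back x = some (e, y) → σ e y = x ∧ y.1 ∈ G.r e ∧ G.s e = x.1
  back_ne_none : ∀ x e, G.s e = x.1 → back x ≠ none

-- If `v` emits an edge, the disjoint union of the sets `r(e) × ℕ` over `s(e) = v` is countably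
-- infinite: countable by hypothesis, infinite because ranges are nonempty and the factor `ℕ` is
-- present. A bijection with `ℕ` identifies it with the fibre `{v} × ℕ`.
open Classical in
theorem exists_branchingSystem [Countable V] [Countable E] : Nonempty (BranchingSystem G) := by
  let W (v : V) : Type (max u v) := {q : E × (V × ℕ) // G.s q.1 = v ∧ q.2.1 ∈ G.r q.1}
  have hW : ∀ v, (∃ e, G.s e = v) → Nonempty (W v ≃ ℕ) := by
    rintro v ⟨e, he⟩
    obtain ⟨w, hw⟩ := G.r_nonempty e
    have : Infinite (W v) := Infinite.of_injective (fun n : ℕ => ⟨(e, (w, n)), he, hw⟩)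
      fun m n h => congrArg (fun q : W v => q.1.2.2) h
    have := (nonempty_denumerable (W v))
    exact this.elim fun d => ⟨Denumerable.eqv _⟩
  let Φ (v : V) (h : ∃ e, G.s e = v) : W v ≃ ℕ := (hW v h).some
  refine ⟨{
    σ := fun e y => if hy : y.1 ∈ G.r e then
      (G.s e, Φ (G.s e) ⟨e, rfl⟩ ⟨(e, y), rfl, hy⟩) else y
    back := fun x => if h : ∃ e, G.s e = x.1 then some ((Φ x.1 h).symm x.2).1 else none
    back_σ := ?_
    of_back := ?_
    back_ne_none := ?_ }⟩
  · intro e y hy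
    have : ∃ e', G.s e' = G.s e := ⟨e, rfl⟩
    rw [dif_pos hy, dif_pos this, Equiv.symm_apply_apply]
  · rintro ⟨v, n⟩ e y h
    by_cases hv : ∃ e, G.s e = v
    · simp only [hv, dite_true, Option.some.injEq] at h
      obtain ⟨q, hq⟩ : ∃ q, q = (Φ v hv).symm n := ⟨_, rfl⟩
      have hn : n = Φ v hv q := by rw [hq]; simp
      obtain ⟨⟨e', y'⟩, h1, h2⟩ := q
      rw [← hq] at h
      simp only [Prod.mk.injEq] at h
      obtain ⟨rfl, rfl⟩ := h
      dsimp only at h1 h2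
      subst h1
      rw [dif_pos h2, ← hn]
      exact ⟨rfl, h2, rfl⟩
    · simp [hv] at h
  · intro x e h
    have : ∃ e, G.s e = x.1 := ⟨e, h⟩
    simp [this]

variable {G}
variable (K : Type w) [Field K] (B : BranchingSystem G)

open Classical in
/-- The action of a generator on functions on `V × ℕ`. -/
def BranchingSystem.act : G.LeavittGenerator → Module.End K (V × ℕ → K)
  | .proj A =>
    { toFun f x := if x.1 ∈ A.1 then f x else 0
      map_add' f g := by ext x; by_cases h : x.1 ∈ A.1 <;> simp [h]
      map_smul' k f := by ext x; by_cases h : x.1 ∈ A.1 <;> simp [h] }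
  | .edge e =>
    { toFun f x := (B.back x).elim 0 fun q => if q.1 = e then f q.2 else 0
      map_add' f g := by
        ext x
        rcases h : B.back x with _ | q
        · simp [h]
        · by_cases h' : q.1 = e <;> simp [h, h']
      map_smul' k f := by
        ext x
        rcases h : B.back x with _ | q
        · simp [h]
        · by_cases h' : q.1 = e <;> simp [h, h'] }
  | .ghost e =>
    { toFun f y := if y.1 ∈ G.r e then f (B.σ e y) else 0
      map_add' f g := by ext y; by_cases h : y.1 ∈ G.r e <;> simp [h]
      map_smul' k f := by ext y; by_cases h : y.1 ∈ G.r e <;> simp [h] }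

open Classical in
theorem BranchingSystem.act_proj {A : Set V} (hA : G.IsGeneralizedVertex A) (f : V × ℕ → K)
    (x : V × ℕ) : B.act K (.proj ⟨A, hA⟩) f x = if x.1 ∈ A then f x else 0 := rfl

open Classical in
theorem BranchingSystem.act_edge (e : E) (f : V × ℕ → K) (x : V × ℕ) :
    B.act K (.edge e) f x = (B.back x).elim 0 fun q => if q.1 = e then f q.2 else 0 := rfl

open Classical in
theorem BranchingSystem.act_ghost (e : E) (f : V × ℕ → K) (y : V × ℕ) :
    B.act K (.ghost e) f y = if y.1 ∈ G.r e then f (B.σ e y) else 0 := rfl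

theorem BranchingSystem.source_of_σ {e : E} {y : V × ℕ} (h : y.1 ∈ G.r e) :
    (B.σ e y).1 = G.s e :=
  (B.of_back _ _ _ (B.back_σ e y h)).2.2.symm

/-- The Leavitt family of operators on functions on `V × ℕ`. -/
def BranchingSystem.family : Family G (Module.End K (V × ℕ → K)) where
  toFun := B.act K
  empty := by ext f x; simp [act_proj]
  mul hB hC := by
    refine LinearMap.ext fun f => funext fun x => ?_
    simp only [Module.End.mul_apply, act_proj, Set.mem_inter_iff]
    split_ifs <;> simp_all
  union hB hC := by
    refine LinearMap.ext fun f => funext fun x => ?_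
    simp only [LinearMap.sub_apply, LinearMap.add_apply, Pi.sub_apply, Pi.add_apply, act_proj,
      Set.mem_inter_iff, Set.mem_union]
    split_ifs <;> simp_all
  source_mul_edge e := by
    refine LinearMap.ext fun f => funext fun x => ?_
    simp only [Module.End.mul_apply, act_proj, act_edge, Set.mem_singleton_iff]
    rcases h : B.back x with _ | ⟨e', y⟩
    · simp
    · obtain ⟨-, -, h3⟩ := B.of_back _ _ _ h
      by_cases he : e' = e
      · subst he; simp [h3]
      · simp [he]
  edge_mul_range e := by
    refine LinearMap.ext fun f => funext fun x => ?_
    simp only [Module.End.mul_apply, act_proj, act_edge]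
    rcases h : B.back x with _ | ⟨e', y⟩
    · simp
    · obtain ⟨-, h2, -⟩ := B.of_back _ _ _ h
      by_cases he : e' = e
      · subst he; simp [h2]
      · simp [he]
  range_mul_ghost e := by
    refine LinearMap.ext fun f => funext fun x => ?_
    simp only [Module.End.mul_apply, act_proj, act_ghost]
    split_ifs <;> rfl
  ghost_mul_source e := by
    refine LinearMap.ext fun f => funext fun x => ?_
    simp only [Module.End.mul_apply, act_proj, act_ghost, Set.mem_singleton_iff]
    split_ifs with h h'
    · rfl
    · exact absurd (B.source_of_σ h) h'
    · rfl
  ghost_mul_edge_self e := by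
    refine LinearMap.ext fun f => funext fun x => ?_
    simp only [Module.End.mul_apply, act_proj, act_ghost, act_edge]
    split_ifs with h
    · simp [B.back_σ e x h]
    · rfl
  ghost_mul_edge_of_ne e e' hne := by
    refine LinearMap.ext fun f => funext fun x => ?_
    simp only [Module.End.mul_apply, act_ghost, act_edge]
    split_ifs with h
    · simp [B.back_σ e x h, hne]
    · rfl
  regular v hv := by
    classical
    refine LinearMap.ext fun f => funext fun x => ?_
    simp only [LinearMap.sum_apply, Finset.sum_apply, Module.End.mul_apply, act_proj, act_ghost,
      act_edge, Set.mem_singleton_iff]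
    -- Each point over a regular vertex lies in the range of exactly one `σ e'`, so exactly one
    -- summand survives; a point in no range lies over a sink.
    rcases h : B.back x with _ | ⟨e', y⟩
    · obtain ⟨e, he⟩ := hv.1
      have : x.1 ≠ v := fun hx => B.back_ne_none x e (he.trans hx.symm) h
      simp [this]
    · obtain ⟨h1, h2, h3⟩ := B.of_back _ _ _ h
      simp [Option.elim_some, Finset.sum_ite_eq, h1, h2, h3]

end Representation

/-- In the representation `p_A` multiplies by the indicator of `A × ℕ`, so it does not kill the
constant function `1`. -/
theorem p_ne_zero {V : Type u} {E : Type v} [Countable V] [Countable E] (G : Ultragraph V E)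
    (K : Type w) [Field K] {A : Set V} (hA : G.IsGeneralizedVertex A) (hne : A.Nonempty) :
    p K G hA ≠ 0 := by
  obtain ⟨v, hv⟩ := hne
  obtain ⟨B⟩ := exists_branchingSystem G
  intro h
  have := congrArg (B.family K).hom h
  rw [Family.hom_p, map_zero] at this
  have := congrFun (LinearMap.congr_fun this fun _ => 1) (v, 0)
  simp [BranchingSystem.family, BranchingSystem.act_proj, hv] at this

end LeavittPathAlgebra

/-! ### Paths and reachability -/

section Reaches

variable {V : Type u} {E : Type v} {G : Ultragraph V E}

theorem Reaches.refl (G : Ultragraph V E) (v : V) : G.Reaches v v :=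
  ⟨.vertex ⟨{v}, .singleton v⟩, rfl, rfl⟩

theorem Reaches.of_edge {e : E} {v w : V} (hv : v ∈ G.r e) (h : G.Reaches v w) :
    G.Reaches (G.s e) w := by
  obtain ⟨q, hs, hr⟩ := h
  cases q with
  | vertex A =>
    refine ⟨.edges [e] (by simp) (by simp), rfl, ?_⟩
    have : w ∈ ({v} : Set V) := hs ▸ hr
    rw [Set.mem_singleton_iff] at this
    subst this
    exact hv
  | edges l hne hl =>
    obtain ⟨f, l, rfl⟩ := List.exists_cons_of_ne_nil hne
    have hf : G.s f = v := Set.singleton_injective hs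
    refine ⟨.edges (e :: f :: l) (by simp) (List.isChain_cons_cons.mpr ⟨by rwa [hf], hl⟩), rfl, ?_⟩
    simpa [FinitePath.range] using hr

/-- Induction along the edges of a path. -/
theorem Reaches.induction {P : V → Prop} (step : ∀ e, P (G.s e) → ∀ w ∈ G.r e, P w) {v w : V}
    (h : G.Reaches v w) (hv : P v) : P w := by
  obtain ⟨q, hs, hr⟩ := h
  cases q with
  | vertex A =>
    have : w ∈ ({v} : Set V) := hs ▸ hr
    rw [Set.mem_singleton_iff] at this
    exact this ▸ hv
  | edges l hne hl =>
    have hv' : P (G.s (l.head hne)) := by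
      have : G.s (l.head hne) = v := Set.singleton_injective hs
      rwa [this]
    clear hs
    induction l with
    | nil => exact absurd rfl hne
    | cons e l ih =>
      cases l with
      | nil => exact step e hv' w hr
      | cons f l =>
        rw [List.isChain_cons_cons] at hl
        exact ih (by simp) hl.2 (by simpa [FinitePath.range] using hr) (step e hv' _ hl.1)

end Reaches

namespace LeavittPathAlgebra

/-! ### Monomials and homogeneous components -/

noncomputable section Monomials

variable (K : Type w) [Field K] {V : Type u} {E : Type v} (G : Ultragraph V E)

/-- The monomials `s_α p_A s_β^*`, with `m = |α|` and `j = |β|`. -/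
inductive IsMonomial : ℕ → ℕ → G.LeavittPathAlgebra K → Prop
  -- Zero has every bidegree, so that products that vanish need no separate treatment.
  | zero (m j : ℕ) : IsMonomial m j 0
  | proj {A : Set V} (hA : G.IsGeneralizedVertex A) : IsMonomial 0 0 (p K G hA)
  | edge_mul (e : E) {m j : ℕ} {x : G.LeavittPathAlgebra K} :
      IsMonomial m j x → IsMonomial (m + 1) j (s K G e * x)
  | mul_ghost (e : E) {m j : ℕ} {x : G.LeavittPathAlgebra K} :
      IsMonomial m j x → IsMonomial m (j + 1) (x * t K G e)

variable {K G}

namespace IsMonomial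

variable {m j : ℕ} {x : G.LeavittPathAlgebra K}

theorem p_mul (h : IsMonomial K G m j x) {A : Set V} (hA : G.IsGeneralizedVertex A) :
    IsMonomial K G m j (p K G hA * x) := by
  induction h with
  | zero => rw [mul_zero]; exact .zero _ _
  | proj hB => rw [p_mul_p]; exact .proj _
  | edge_mul e hx _ =>
    rw [← mul_assoc, p_mul_s]
    split_ifs
    · exact .edge_mul e hx
    · rw [zero_mul]; exact .zero _ _
  | mul_ghost e _ ih => rw [← mul_assoc]; exact .mul_ghost e ih

theorem mul_p (h : IsMonomial K G m j x) {A : Set V} (hA : G.IsGeneralizedVertex A) :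
    IsMonomial K G m j (x * p K G hA) := by
  induction h with
  | zero => rw [zero_mul]; exact .zero _ _
  | proj hB => rw [p_mul_p]; exact .proj _
  | edge_mul e _ ih => rw [mul_assoc]; exact .edge_mul e ih
  | mul_ghost e hx _ =>
    rw [mul_assoc, t_mul_p]
    split_ifs
    · exact .mul_ghost e hx
    · rw [mul_zero]; exact .zero _ _

/-- A ghost edge on the left cancels the first real edge; if there is none, it joins the ghost part.
Edges on the right behave symmetrically. In all four cases `m - j` changes by exactly one, as the
grading requires. -/
theorem t_mul_succ (h : IsMonomial K G (m + 1) j x) (e : E) :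
    IsMonomial K G m j (t K G e * x) := by
  generalize hn : m + 1 = n at h
  induction h with
  | zero => rw [mul_zero]; exact .zero _ _
  | proj hB => simp at hn
  | edge_mul f hx _ =>
    obtain rfl := Nat.succ_injective hn
    rw [← mul_assoc, t_mul_s]
    split_ifs
    · exact hx.p_mul _
    · rw [zero_mul]; exact .zero _ _
  | mul_ghost f _ ih => rw [← mul_assoc]; exact .mul_ghost f (ih hn)

theorem t_mul_zero (h : IsMonomial K G 0 j x) (e : E) :
    IsMonomial K G 0 (j + 1) (t K G e * x) := by
  generalize hn : 0 = n at h
  induction h with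
  | zero => rw [mul_zero]; exact .zero _ _
  | proj hB =>
    rw [t_mul_p]
    split_ifs
    · rw [← p_range_mul_t]; exact .mul_ghost e (.proj _)
    · exact .zero _ _
  | edge_mul f hx _ => simp at hn
  | mul_ghost f _ ih => rw [← mul_assoc]; exact .mul_ghost f (ih hn)

theorem mul_s_succ (h : IsMonomial K G m (j + 1) x) (e : E) :
    IsMonomial K G m j (x * s K G e) := by
  generalize hn : j + 1 = n at h
  induction h with
  | zero => rw [zero_mul]; exact .zero _ _
  | proj hB => simp at hn
  | edge_mul f _ ih => rw [mul_assoc]; exact .edge_mul f (ih hn)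
  | mul_ghost f hx _ =>
    obtain rfl := Nat.succ_injective hn
    rw [mul_assoc, t_mul_s]
    split_ifs
    · exact hx.mul_p _
    · rw [mul_zero]; exact .zero _ _

theorem mul_s_zero (h : IsMonomial K G m 0 x) (e : E) :
    IsMonomial K G (m + 1) 0 (x * s K G e) := by
  generalize hn : 0 = n at h
  induction h with
  | zero => rw [zero_mul]; exact .zero _ _
  | proj hB =>
    rw [p_mul_s]
    split_ifs
    · rw [← s_mul_p_range]; exact .edge_mul e (.proj _)
    · exact .zero _ _
  | edge_mul f _ ih => rw [mul_assoc]; exact .edge_mul f (ih hn)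
  | mul_ghost f hx _ => simp at hn

/-- A nonzero monomial between two sets of vertices connects them. -/
theorem exists_reaches (h : IsMonomial K G m j x) {B C : Set V} (hB : G.IsGeneralizedVertex B)
    (hC : G.IsGeneralizedVertex C) (hne : p K G hB * x * p K G hC ≠ 0) :
    ∃ b ∈ B, ∃ c ∈ C, ∃ u, G.Reaches b u ∧ G.Reaches c u := by
  -- `B` and `C` must vary: since `s_e = s_e p_{r(e)}`, removing a real edge replaces `B` by `r(e)`,
  -- and removing a ghost edge does the same to `C`.
  induction h generalizing B C with
  | zero => simp at hne
  | @proj A hA =>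
    rw [p_mul_p, p_mul_p] at hne
    obtain ⟨v, ⟨hv, -⟩, hv'⟩ : (B ∩ A ∩ C).Nonempty := by
      by_contra h
      exact hne (p_eq_zero_of_eq_empty _ (Set.not_nonempty_iff_eq_empty.mp h))
    exact ⟨v, hv, v, hv', v, .refl _ _, .refl _ _⟩
  | edge_mul e _ ih =>
    rw [← mul_assoc, p_mul_s] at hne
    split_ifs at hne with he
    · obtain ⟨b, hb, c, hc, u, hbu, hcu⟩ := ih (.range e) hC (by
        intro h0
        rw [← s_mul_p_range, mul_assoc, mul_assoc, ← mul_assoc (p K G _), h0, mul_zero] at hne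
        exact hne rfl)
      exact ⟨_, he, c, hc, u, hbu.of_edge hb, hcu⟩
    · simp at hne
  | mul_ghost e _ ih =>
    rw [mul_assoc, mul_assoc, t_mul_p] at hne
    split_ifs at hne with he
    · obtain ⟨b, hb, c, hc, u, hbu, hcu⟩ := ih hB (.range e) (by
        intro h0
        rw [← p_range_mul_t, ← mul_assoc, ← mul_assoc, h0, zero_mul] at hne
        exact hne rfl)
      exact ⟨b, hb, _, he, u, hbu, hcu.of_edge hc⟩
    · simp at hne

end IsMonomial

variable (K G) in
/-- The homogeneous component of degree `d`. -/
def degreePart (d : ℤ) : Submodule K (G.LeavittPathAlgebra K) :=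
  Submodule.span K {x | ∃ m j : ℕ, IsMonomial K G m j x ∧ (m : ℤ) - j = d}

variable (K G) in
/-- The span of the monomials `s_α p_A s_β^*` of degree `d` with `|β| ≤ N`. -/
def degreePartLE (N : ℕ) (d : ℤ) : Submodule K (G.LeavittPathAlgebra K) :=
  Submodule.span K {x | ∃ m j : ℕ, IsMonomial K G m j x ∧ j ≤ N ∧ (m : ℤ) - j = d}

theorem degreePartLE_mono {M N : ℕ} (h : M ≤ N) (d : ℤ) :
    degreePartLE K G M d ≤ degreePartLE K G N d :=
  Submodule.span_mono fun _ ⟨m, j, hx, hj, hd⟩ => ⟨m, j, hx, hj.trans h, hd⟩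

theorem exists_mem_degreePartLE {d : ℤ} {x : G.LeavittPathAlgebra K} (h : x ∈ degreePart K G d) :
    ∃ N, x ∈ degreePartLE K G N d := by
  induction h using Submodule.span_induction with
  | mem x h =>
    obtain ⟨m, j, hx, hd⟩ := h
    exact ⟨j, Submodule.subset_span ⟨m, j, hx, le_rfl, hd⟩⟩
  | zero => exact ⟨0, zero_mem _⟩
  | add x y _ _ ihx ihy =>
    obtain ⟨M, hM⟩ := ihx
    obtain ⟨N, hN⟩ := ihy
    exact ⟨max M N, add_mem (degreePartLE_mono (le_max_left _ _) d hM)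
      (degreePartLE_mono (le_max_right _ _) d hN)⟩
  | smul k x _ ih =>
    obtain ⟨N, hN⟩ := ih
    exact ⟨N, Submodule.smul_mem _ k hN⟩

variable (K G) in
/-- The monomials span the Leavitt path algebra. -/
theorem span_isMonomial :
    Submodule.span K {x | ∃ m j : ℕ, IsMonomial K G m j x} = ⊤ := by
  set T := Submodule.span K {x | ∃ m j : ℕ, IsMonomial K G m j x} with hT
  have hgen : ∀ g : G.LeavittGenerator, mk K G (FreeLeavitt.of K g) ∈ T := by
    rintro (⟨A, hA⟩ | e | e)
    · exact Submodule.subset_span ⟨_, _, .proj hA⟩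
    · have : mk K G (FreeLeavitt.of K (.edge e)) = p K G (.singleton (G.s e)) * s K G e :=
        (p_source_mul_s e).symm
      rw [this]
      exact Submodule.subset_span ⟨_, _, (IsMonomial.proj _).mul_s_zero e⟩
    · have : mk K G (FreeLeavitt.of K (.ghost e)) = p K G (.range e) * t K G e :=
        (p_range_mul_t e).symm
      rw [this]
      exact Submodule.subset_span ⟨_, _, (IsMonomial.proj _).mul_ghost e⟩
  have hmul : ∀ (g : G.LeavittGenerator), ∀ x ∈ T, mk K G (FreeLeavitt.of K g) * x ∈ T := by
    intro g x hx
    induction hx using Submodule.span_induction with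
    | mem x h =>
      obtain ⟨m, j, hx⟩ := h
      rcases g with ⟨A, hA⟩ | e | e
      · exact Submodule.subset_span ⟨_, _, hx.p_mul hA⟩
      · exact Submodule.subset_span ⟨_, _, hx.edge_mul e⟩
      · cases m with
        | zero => exact Submodule.subset_span ⟨_, _, hx.t_mul_zero e⟩
        | succ m => exact Submodule.subset_span ⟨_, _, hx.t_mul_succ e⟩
    | zero => rw [mul_zero]; exact zero_mem _
    | add x y _ _ ihx ihy => rw [mul_add]; exact add_mem ihx ihy
    | smul k x _ ih => rw [mul_smul_comm]; exact Submodule.smul_mem _ k ih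
  -- The span is stable under left multiplication by generators, so it contains every word.
  have hword : ∀ q : FreeSemigroup G.LeavittGenerator, mk K G (MonoidAlgebra.single q 1) ∈ T := by
    intro q
    induction q using FreeSemigroup.recOnMul with
    | ih1 g => exact hgen g
    | ih2 g q _ ih =>
      have := hmul g _ ih
      rwa [← mk_mul, FreeLeavitt.of, MonoidAlgebra.single_mul_single, one_mul] at this
  refine eq_top_iff.mpr fun x _ => ?_
  obtain ⟨a, rfl⟩ := mk_surjective x
  rw [← MonoidAlgebra.sum_coeff_single a, Finsupp.sum]
  have : mk K G (∑ q ∈ a.coeff.support, MonoidAlgebra.single q (a.coeff q)) =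
      ∑ q ∈ a.coeff.support, mk K G (MonoidAlgebra.single q (a.coeff q)) :=
    map_sum (mkHom K G) _ _
  rw [this]
  refine sum_mem fun q _ => ?_
  have hq : MonoidAlgebra.single q (a.coeff q) = a.coeff q • MonoidAlgebra.single q (1 : K) := by
    rw [MonoidAlgebra.smul_single, smul_eq_mul, mul_one]
  rw [hq, mk_smul]
  exact Submodule.smul_mem _ _ (hword q)

variable (K G) in
theorem iSup_degreePart : ⨆ d, degreePart K G d = ⊤ := by
  rw [eq_top_iff, ← span_isMonomial, Submodule.span_le]
  rintro x ⟨m, j, hx⟩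
  exact Submodule.mem_iSup_of_mem _ (Submodule.subset_span ⟨m, j, hx, rfl⟩)

end Monomials

/-! ### Reduction of a homogeneous element to a vertex -/

section Reduction

variable {K : Type w} [Field K] {V : Type u} {E : Type v} {G : Ultragraph V E}

theorem p_eq_inter_add_diff {A B : Set V} (hB : G.IsGeneralizedVertex B)
    (hA : G.IsGeneralizedVertex A) : p K G hB = p K G (hB.inter hA) + p K G (hB.diff hA) := by
  rw [p_congr hB (Set.inter_union_sdiff B A).symm, p_union (hB.inter hA) (hB.diff hA),
    p_eq_zero_of_eq_empty ((hB.inter hA).inter (hB.diff hA)), sub_zero]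
  ext v
  simp +contextual

open Classical in
/-- A combination of projections vanishes on a set if its coefficient function does. -/
theorem smul_p_add_p_mul_sum_eq_zero {ι : Type*} (S : Finset ι) (k : ι → K) (A : ι → Set V)
    (hA : ∀ i, G.IsGeneralizedVertex (A i)) {B : Set V} (hB : G.IsGeneralizedVertex B) (c : K)
    (h : ∀ v ∈ B, c + ∑ i ∈ S, (if v ∈ A i then k i else 0) = 0) :
    c • p K G hB + p K G hB * ∑ i ∈ S, k i • p K G (hA i) = 0 := by
  induction S using Finset.induction_on generalizing B c with
  | empty =>
    simp only [Finset.sum_empty, add_zero, mul_zero] at h ⊢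
    rcases B.eq_empty_or_nonempty with rfl | ⟨v, hv⟩
    · rw [p_eq_zero_of_eq_empty hB rfl, smul_zero]
    · rw [h v hv, zero_smul]
  | insert i S hi ih =>
    -- Split `B` along `A i`: on `B ∩ A i` the constant absorbs `k i`, on `B \ A i` it stays `c`.
    -- This is why the statement carries a constant and an arbitrary `B`.
    have h1 := ih (hB.inter (hA i)) (c + k i) fun v hv => by
      have := h v hv.1
      rw [Finset.sum_insert hi, if_pos hv.2] at this
      rwa [← add_assoc] at this
    have h2 := ih (hB.diff (hA i)) c fun v hv => by
      have := h v hv.1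
      rwa [Finset.sum_insert hi, if_neg hv.2, zero_add] at this
    rw [Finset.sum_insert hi, mul_add, mul_smul_comm, p_mul_p]
    have h3 := p_eq_inter_add_diff (K := K) hB (hA i)
    rw [h3, add_mul, ← add_zero (0 : G.LeavittPathAlgebra K)]
    nth_rw 2 [← h2]
    rw [← h1, add_smul, smul_add]
    abel

/-- A nonzero combination of projections can be cut down to a nonzero multiple of a vertex. -/
theorem exists_mul_p_singleton_of_mem_span {y : G.LeavittPathAlgebra K}
    (hy : y ∈ Submodule.span K (Set.range fun A : G.GeneralizedVertex => p K G A.2))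
    (hne : y ≠ 0) : ∃ v, ∃ k : K, k ≠ 0 ∧
      p K G (.singleton v) * y * p K G (.singleton v) = k • p K G (.singleton v) := by
  classical
  obtain ⟨c, rfl⟩ := Finsupp.mem_span_range_iff_exists_finsupp.mp hy
  rw [Finsupp.sum] at hne ⊢
  have hpv : ∀ v, p K G (.singleton v) * (∑ A ∈ c.support, c A • p K G A.2) =
      (∑ A ∈ c.support, if v ∈ A.1 then c A else 0) • p K G (.singleton v) := by
    intro v
    rw [Finset.mul_sum, Finset.sum_smul]
    refine Finset.sum_congr rfl fun A _ => ?_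
    rw [mul_smul_comm, p_singleton_mul_p]
    split_ifs <;> simp
  have hpp : ∀ v, p K G (.singleton v) * p K G (.singleton v) = p K G (.singleton v) :=
    fun v => p_mul_p_of_subset _ _ subset_rfl
  -- `p_v y` is the coefficient function at `v` times `p_v`. If that function vanished everywhere,
  -- then `y = p_B y = 0`, where `B` contains every set that occurs in `y`.
  suffices h : ∃ v, (∑ A ∈ c.support, if v ∈ A.1 then c A else 0) ≠ 0 by
    obtain ⟨v, hv⟩ := h
    refine ⟨v, _, hv, ?_⟩
    rw [hpv, smul_mul_assoc, hpp]
  by_contra! h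
  have hunit : ∀ S : Finset G.GeneralizedVertex, ∃ B : Set V, G.IsGeneralizedVertex B ∧
      ∀ A ∈ S, A.1 ⊆ B := by
    intro S
    induction S using Finset.induction_on with
    | empty => exact ⟨∅, .empty, by simp⟩
    | insert A S _ ih =>
      obtain ⟨B, hB, hS⟩ := ih
      refine ⟨A.1 ∪ B, A.2.union hB, fun C hC => ?_⟩
      rcases Finset.mem_insert.mp hC with rfl | hC
      · exact Set.subset_union_left
      · exact (hS C hC).trans Set.subset_union_right
  obtain ⟨B, hB, hS⟩ := hunit c.support
  have h0 := smul_p_add_p_mul_sum_eq_zero c.support c (fun A => A.1) (fun A => A.2) hB 0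
    fun v _ => by rw [zero_add]; exact h v
  rw [zero_smul, zero_add, Finset.mul_sum] at h0
  refine hne (Eq.trans (Finset.sum_congr rfl fun A hA => ?_) h0)
  rw [mul_smul_comm, p_mul_p_of_subset _ _ (hS A hA)]

/-- A nonzero combination of real paths of the same length can be multiplied to a nonzero multiple
of a vertex. -/
theorem exists_mul_mul_p_of_mem_span (m : ℕ) {y : G.LeavittPathAlgebra K}
    (hy : y ∈ Submodule.span K {x | IsMonomial K G m 0 x}) (hne : y ≠ 0) :
    ∃ a v, ∃ k : K, k ≠ 0 ∧ a * y * p K G (.singleton v) = k • p K G (.singleton v) := by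
  induction m generalizing y with
  | zero =>
    obtain ⟨v, k, hk, h⟩ := exists_mul_p_singleton_of_mem_span (y := y) (by
      refine Submodule.span_le.mpr (fun x hx => ?_) hy
      cases hx with
      | zero => exact zero_mem _
      | @proj A hA => exact Submodule.subset_span ⟨⟨A, hA⟩, rfl⟩) hne
    exact ⟨_, v, k, hk, h⟩
  | succ m ih =>
    -- Group the paths by first edge: `y = ∑ f e` with `f e ∈ s_e L`. Since `s_e t_e` fixes `f e`
    -- and `t_e` kills the other terms, `t_e y ≠ 0` for some `e`, and `t_e y` involves paths one
    -- edge shorter.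
    have hy' : y ∈ ⨆ e, (⊤ : Submodule K (G.LeavittPathAlgebra K)).map
        (LinearMap.mulLeft K (s K G e)) := by
      refine Submodule.span_le.mpr (fun x hx => ?_) hy
      cases hx with
      | zero => exact zero_mem _
      | @edge_mul e _ _ x hx =>
        exact Submodule.mem_iSup_of_mem e ⟨x, trivial, rfl⟩
    obtain ⟨f, hf, rfl⟩ := (Submodule.mem_iSup_iff_exists_finsupp _ _).mp hy'
    have hst : ∀ e, s K G e * (t K G e * f e) = f e := by
      intro e
      obtain ⟨x, -, hx⟩ := hf e
      rw [← hx, LinearMap.mulLeft_apply, ← mul_assoc (t K G e), t_mul_s_self, ← mul_assoc,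
        s_mul_p_range]
    have ht : ∀ e e', e ≠ e' → t K G e * f e' = 0 := by
      intro e e' h
      obtain ⟨x, -, hx⟩ := hf e'
      rw [← hx, LinearMap.mulLeft_apply, ← mul_assoc, t_mul_s_of_ne h, zero_mul]
    rw [Finsupp.sum] at *
    obtain ⟨e, he⟩ : ∃ e, t K G e * (∑ i ∈ f.support, f i) ≠ 0 := by
      by_contra! h
      refine hne (Finset.sum_eq_zero fun e he => ?_)
      have := h e
      rw [Finset.mul_sum, Finset.sum_eq_single_of_mem e he fun e' _ h => ht e e' h.symm] at this
      rw [← hst, this, mul_zero]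
    have hmem : t K G e * (∑ i ∈ f.support, f i) ∈
        Submodule.span K {x | IsMonomial K G m 0 x} := by
      have : Submodule.span K {x | IsMonomial K G (m + 1) 0 x} ≤
          (Submodule.span K {x | IsMonomial K G m 0 x}).comap (LinearMap.mulLeft K (t K G e)) :=
        Submodule.span_le.mpr fun x hx => Submodule.subset_span (hx.t_mul_succ e)
      exact this hy
    obtain ⟨a, v, k, hk, h⟩ := ih hmem he
    exact ⟨a * t K G e, v, k, hk, by rw [← h, mul_assoc a]⟩

/-- Without ghost edges the degree is the path length. For negative `d` there are no such monomials
and the left side is zero, so the value of `toNat` does not matter. -/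
theorem degreePartLE_zero_le (d : ℤ) :
    degreePartLE K G 0 d ≤ Submodule.span K {x | IsMonomial K G d.toNat 0 x} := by
  refine Submodule.span_mono ?_
  rintro x ⟨m, j, hx, hj, hd⟩
  obtain rfl := Nat.le_zero.mp hj
  have : d.toNat = m := by omega
  rwa [Set.mem_ofPred_eq, this]

/-- Multiplying by an edge shortens a nonempty ghost part, and lengthens the real path when there is
no ghost part; so the bound on ghost length drops by one. This drives the induction in
`exists_mul_mul_eq_p`. -/
theorem mul_s_mem_degreePartLE {N : ℕ} {d : ℤ} {x : G.LeavittPathAlgebra K}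
    (hx : x ∈ degreePartLE K G (N + 1) d) (e : E) :
    x * s K G e ∈ degreePartLE K G N (d + 1) := by
  have : degreePartLE K G (N + 1) d ≤
      (degreePartLE K G N (d + 1)).comap (LinearMap.mulRight K (s K G e)) := by
    refine Submodule.span_le.mpr ?_
    rintro x ⟨m, j, hx, hj, hd⟩
    cases j with
    | zero =>
      exact Submodule.subset_span ⟨_, _, hx.mul_s_zero e, N.zero_le, by push_cast at hd ⊢; omega⟩
    | succ j =>
      exact Submodule.subset_span ⟨_, _, hx.mul_s_succ e, by omega, by push_cast at hd ⊢; omega⟩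
  exact this hx

theorem mul_p_mem_degreePartLE {N : ℕ} {d : ℤ} {x : G.LeavittPathAlgebra K}
    (hx : x ∈ degreePartLE K G N d) {A : Set V} (hA : G.IsGeneralizedVertex A) :
    x * p K G hA ∈ degreePartLE K G N d := by
  have : degreePartLE K G N d ≤ (degreePartLE K G N d).comap (LinearMap.mulRight K (p K G hA)) :=
    Submodule.span_le.mpr fun x ⟨m, j, hx, hj, hd⟩ =>
      Submodule.subset_span ⟨m, j, hx.mul_p hA, hj, hd⟩
  exact this hx

theorem IsMonomial.eq_zero_or_eq_mul_t {m j : ℕ} {x : G.LeavittPathAlgebra K}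
    (h : IsMonomial K G m (j + 1) x) : x = 0 ∨ ∃ e x', x = x' * t K G e := by
  generalize hn : j + 1 = n at h
  induction h with
  | zero => exact .inl rfl
  | proj => simp at hn
  | edge_mul f _ ih =>
    rcases ih hn with rfl | ⟨e, x', rfl⟩
    · exact .inl (mul_zero _)
    · exact .inr ⟨e, s K G f * x', (mul_assoc _ _ _).symm⟩
  | @mul_ghost e _ _ x _ _ => exact .inr ⟨e, x, rfl⟩

theorem degreePartLE_le_sup (N : ℕ) (d : ℤ) : degreePartLE K G N d ≤
    degreePartLE K G 0 d ⊔ ⨆ e, (⊤ : Submodule K (G.LeavittPathAlgebra K)).map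
      (LinearMap.mulRight K (t K G e)) := by
  refine Submodule.span_le.mpr ?_
  rintro x ⟨m, j, hx, hj, hd⟩
  cases j with
  | zero => exact Submodule.mem_sup_left (Submodule.subset_span ⟨m, 0, hx, le_rfl, hd⟩)
  | succ j =>
    rcases hx.eq_zero_or_eq_mul_t with rfl | ⟨e, x, rfl⟩
    · exact zero_mem _
    · exact Submodule.mem_sup_right (Submodule.mem_iSup_of_mem e ⟨x, trivial, rfl⟩)

/-- Modulo projections at regular vertices that annihilate it, an element is a combination of real
paths and of elements that end in a ghost edge with singular source. -/
theorem exists_eq_add_sum {N : ℕ} {d : ℤ} {x : G.LeavittPathAlgebra K}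
    (hx : x ∈ degreePartLE K G N d)
    (hreg : ∀ v, G.IsRegular v → x * p K G (.singleton v) = 0) :
    ∃ y ∈ degreePartLE K G 0 d, ∃ (F : Finset E) (g : E → G.LeavittPathAlgebra K),
      (∀ e ∈ F, ¬ G.IsRegular (G.s e)) ∧ x = y + ∑ e ∈ F, g e * t K G e := by
  classical
  obtain ⟨y, hy, z, hz, rfl⟩ := Submodule.mem_sup.mp (degreePartLE_le_sup N d hx)
  obtain ⟨f, hf, rfl⟩ := (Submodule.mem_iSup_iff_exists_finsupp _ _).mp hz
  choose g _ hg using hf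
  simp only [LinearMap.mulRight_apply] at hg
  rw [Finsupp.sum] at *
  -- Multiplying `x` by `∑ v ∈ W, p_v` gives zero, and expresses the ghost terms with regular source
  -- as `-∑ v ∈ W, y p_v`. These are real paths and can be absorbed into `y`.
  set W := (f.support.image G.s).filter G.IsRegular with hW
  have h0 : ∑ v ∈ W, (y + ∑ e ∈ f.support, f e) * p K G (.singleton v) = 0 :=
    Finset.sum_eq_zero fun v hv => hreg v (Finset.mem_filter.mp hv).2
  refine ⟨y - ∑ v ∈ W, y * p K G (.singleton v),
    sub_mem hy (sum_mem fun v _ => mul_p_mem_degreePartLE hy _),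
    f.support.filter fun e => ¬ G.IsRegular (G.s e), g, fun e he => (Finset.mem_filter.mp he).2, ?_⟩
  have h1 : ∑ v ∈ W, (∑ e ∈ f.support, f e) * p K G (.singleton v) =
      ∑ e ∈ f.support with G.IsRegular (G.s e), f e := by
    simp_rw [Finset.sum_mul]
    rw [Finset.sum_comm, Finset.sum_filter]
    refine Finset.sum_congr rfl fun e he => ?_
    simp_rw [← hg, mul_assoc, t_mul_p, Set.mem_singleton_iff, mul_ite, mul_zero]
    rw [Finset.sum_ite_eq]
    refine if_congr ?_ rfl rfl
    rw [hW, Finset.mem_filter]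
    exact ⟨And.right, fun h => ⟨Finset.mem_image_of_mem _ he, h⟩⟩
  simp_rw [add_mul, Finset.sum_add_distrib] at h0
  rw [h1] at h0
  simp_rw [hg]
  rw [← Finset.sum_filter_add_sum_filter_not f.support (fun e => G.IsRegular (G.s e)),
    ← sub_eq_zero, ← h0]
  abel

/-- A nonzero homogeneous element can be multiplied to a vertex. -/
theorem exists_mul_mul_eq_p [Countable V] [Countable E] (N : ℕ) (d : ℤ)
    {x : G.LeavittPathAlgebra K} (hx : x ∈ degreePartLE K G N d) (hne : x ≠ 0) :
    ∃ a b v, a * x * b = p K G (.singleton v) := by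
  induction N generalizing d x with
  | zero =>
    obtain ⟨a, v, k, hk, h⟩ := exists_mul_mul_p_of_mem_span _ (degreePartLE_zero_le d hx) hne
    refine ⟨k⁻¹ • a, p K G (.singleton v), v, ?_⟩
    rw [smul_mul_assoc, smul_mul_assoc, h, inv_smul_smul₀ hk]
  | succ N ih =>
    by_cases hs : ∃ e, x * s K G e ≠ 0
    · obtain ⟨e, he⟩ := hs
      obtain ⟨a, b, v, h⟩ := ih _ (mul_s_mem_degreePartLE hx e) he
      exact ⟨a, s K G e * b, v, by rw [← h, mul_assoc, mul_assoc, mul_assoc]⟩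
    -- Now `x s_e = 0` for every `e`, hence `x p_v = 0` at regular `v` by relation (4).
    push Not at hs
    obtain ⟨y, hy, F, g, hF, hxy⟩ := exists_eq_add_sum hx fun v hv => by
      rw [p_regular hv, Finset.mul_sum]
      exact Finset.sum_eq_zero fun e _ => by rw [← mul_assoc, hs, zero_mul]
    -- If `y = 0`, then `x s_e = g_e p_{r(e)} = 0` for each `e ∈ F`, so every term `g_e t_e`
    -- vanishes and `x = 0`.
    have hy0 : y ≠ 0 := by
      rintro rfl
      refine hne ?_
      rw [hxy, zero_add]
      refine Finset.sum_eq_zero fun e he => ?_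
      have h := hs e
      rw [hxy, zero_add, Finset.sum_mul, Finset.sum_eq_single_of_mem e he fun e' _ h => by
        rw [mul_assoc, t_mul_s_of_ne h, mul_zero], mul_assoc, t_mul_s_self] at h
      rw [← p_range_mul_t, ← mul_assoc, h, zero_mul]
    obtain ⟨a, v, k, hk, h⟩ := exists_mul_mul_p_of_mem_span _ (degreePartLE_zero_le d hy) hy0
    -- If `v` is the source of an edge in `F`, it is an infinite emitter and emits some `e' ∉ F`.
    -- Then `y s_{e'} = x s_{e'} = 0`, so `k s_{e'} = a y p_v s_{e'} = 0`, which is impossible.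
    -- Otherwise `p_v` kills all ghost terms, and `x p_v = y p_v`.
    by_cases hv : ∃ e ∈ F, G.s e = v
    · exfalso
      obtain ⟨e, he, rfl⟩ := hv
      have hinf : {e' | G.s e' = G.s e}.Infinite := fun hfin => hF e he ⟨⟨e, rfl⟩, hfin⟩
      obtain ⟨e', he', heF⟩ := hinf.exists_notMem_finset F
      have hy' := hs e'
      rw [hxy, add_mul, Finset.sum_mul, Finset.sum_eq_zero (s := F) fun f hf => by
        rw [mul_assoc, t_mul_s_of_ne fun h : f = e' => heF (h ▸ hf), mul_zero], add_zero] at hy'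
      have hse : p K G (.singleton (G.s e)) * s K G e' = s K G e' := by
        rw [p_mul_s, if_pos (Set.mem_singleton_iff.mpr he')]
      have h2 := congrArg (· * s K G e') h
      simp only [smul_mul_assoc] at h2
      rw [mul_assoc, hse, mul_assoc, hy', mul_zero] at h2
      have h3 : s K G e' = 0 := (smul_eq_zero_iff_right hk).mp h2.symm
      exact p_ne_zero G K (.range e') (G.r_nonempty e') (by rw [← t_mul_s_self, h3, mul_zero])
    · push Not at hv
      refine ⟨k⁻¹ • a, p K G (.singleton v), v, ?_⟩
      have hxv : x * p K G (.singleton v) = y * p K G (.singleton v) := by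
        rw [hxy, add_mul, Finset.sum_mul, Finset.sum_eq_zero (s := F) fun f hf => by
          rw [mul_assoc, t_mul_p, if_neg (mt Set.mem_singleton_iff.mp (hv f hf)), mul_zero], add_zero]
      rw [smul_mul_assoc, smul_mul_assoc, mul_assoc, hxv, ← mul_assoc, h, inv_smul_smul₀ hk]

end Reduction

/-! ### The ℤ-grading through a coaction -/

noncomputable section Grading

variable (K : Type w) [Field K] {V : Type u} {E : Type v} (G : Ultragraph V E)

/-- Laurent polynomials over the unitization of the Leavitt path algebra. -/
abbrev LaurentExtension : Type (max u v w) :=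
  AddMonoidAlgebra (Unitization K (G.LeavittPathAlgebra K)) ℤ

variable {K G} in
/-- The element `x tᵈ`. -/
def monomial (d : ℤ) (x : G.LeavittPathAlgebra K) : LaurentExtension K G :=
  AddMonoidAlgebra.single d (Unitization.inr x)

variable {K G}

theorem monomial_mul (c d : ℤ) (x y : G.LeavittPathAlgebra K) :
    monomial c x * monomial d y = monomial (c + d) (x * y) := by
  rw [monomial, monomial, AddMonoidAlgebra.single_mul_single, ← Unitization.inr_mul, monomial]

theorem monomial_zero (d : ℤ) : monomial d (0 : G.LeavittPathAlgebra K) = 0 := by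
  simp [monomial]

theorem monomial_add (d : ℤ) (x y : G.LeavittPathAlgebra K) :
    monomial d (x + y) = monomial d x + monomial d y := by
  simp [monomial]

theorem monomial_smul (d : ℤ) (k : K) (x : G.LeavittPathAlgebra K) :
    monomial d (k • x) = k • monomial d x := by
  rw [monomial, monomial, AddMonoidAlgebra.smul_single, Unitization.inr_smul]

variable (K G) in
/-- `monomial d` as a linear map. -/
def monomialHom (d : ℤ) : G.LeavittPathAlgebra K →ₗ[K] LaurentExtension K G where
  toFun := monomial d
  map_add' := monomial_add d
  map_smul' k x := monomial_smul d k x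

variable (K G) in
/-- The Leavitt family that gives each edge degree `1` and each ghost edge degree `-1`. -/
def gradingFamily : Family G (LaurentExtension K G) where
  toFun
    | .proj A => monomial 0 (p K G A.2)
    | .edge e => monomial 1 (s K G e)
    | .ghost e => monomial (-1) (t K G e)
  empty := (congrArg (monomial 0) p_empty).trans (monomial_zero 0)
  mul hB hC := by rw [monomial_mul, p_mul_p, add_zero]
  union hB hC :=
    (congrArg (monomial 0) (p_union hB hC)).trans <| ((monomialHom K G 0).map_sub _ _).trans
      (congrArg (· - _) ((monomialHom K G 0).map_add _ _))
  source_mul_edge e := by rw [monomial_mul, p_source_mul_s, zero_add]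
  edge_mul_range e := by rw [monomial_mul, s_mul_p_range, add_zero]
  range_mul_ghost e := by rw [monomial_mul, p_range_mul_t, zero_add]
  ghost_mul_source e := by rw [monomial_mul, t_mul_p_source, add_zero]
  ghost_mul_edge_self e := by rw [monomial_mul, t_mul_s_self, neg_add_cancel]
  ghost_mul_edge_of_ne e f h := by rw [monomial_mul, t_mul_s_of_ne h, monomial_zero]
  regular v hv := by
    simp_rw [monomial_mul, add_neg_cancel]
    rw [p_regular hv]
    exact map_sum (monomialHom K G 0) _ _

variable (K G) in
/-- The coaction `x ↦ x tᵈ` for `x` homogeneous of degree `d`. -/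
def coaction : G.LeavittPathAlgebra K →ₙₐ[K] LaurentExtension K G := (gradingFamily K G).hom

theorem coaction_of_isMonomial {m j : ℕ} {x : G.LeavittPathAlgebra K}
    (h : IsMonomial K G m j x) : coaction K G x = monomial ((m : ℤ) - j) x := by
  induction h with
  | zero => rw [map_zero, monomial_zero]
  | proj hA => exact (gradingFamily K G).hom_p hA
  | edge_mul e _ ih =>
    have : coaction K G (s K G e) = monomial 1 (s K G e) := (gradingFamily K G).hom_s e
    rw [map_mul, ih, this, monomial_mul]
    congr 1
    push_cast; ring
  | mul_ghost e _ ih =>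
    have : coaction K G (t K G e) = monomial (-1) (t K G e) := (gradingFamily K G).hom_t e
    rw [map_mul, ih, this, monomial_mul]
    congr 1
    push_cast; ring

theorem coaction_of_mem_degreePart {d : ℤ} {x : G.LeavittPathAlgebra K}
    (h : x ∈ degreePart K G d) : coaction K G x = monomial d x := by
  induction h using Submodule.span_induction with
  | mem x h =>
    obtain ⟨m, j, hx, rfl⟩ := h
    exact coaction_of_isMonomial hx
  | zero => rw [map_zero, monomial_zero]
  | add x y _ _ ihx ihy => rw [map_add, ihx, ihy, monomial_add]
  | smul k x _ ih => rw [map_smul, ih, monomial_smul]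

/-- The coaction records the degree as the exponent, so its coefficients recover the homogeneous
components. This is the independence of the components in the form that is used. -/
theorem coaction_coeff_of_sum {f : ℤ →₀ G.LeavittPathAlgebra K}
    (hf : ∀ d, f d ∈ degreePart K G d) (d : ℤ) :
    (coaction K G (∑ i ∈ f.support, f i)).coeff d = Unitization.inr (f d) := by
  rw [map_sum, AddMonoidAlgebra.coeff_sum, Finsupp.finsetSum_apply]
  simp_rw [coaction_of_mem_degreePart (hf _), monomial, AddMonoidAlgebra.coeff_single]
  by_cases hd : d ∈ f.support
  · rw [Finset.sum_eq_single_of_mem d hd fun i _ hi => Finsupp.single_eq_of_ne' hi,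
      Finsupp.single_eq_same]
  · rw [Finset.sum_eq_zero fun i hi => Finsupp.single_eq_of_ne' (by rintro rfl; exact hd hi),
      Finsupp.notMem_support_iff.mp hd, Unitization.inr_zero]

/-- If `x L y = 0` for nonzero `x` and `y`, then this holds for their leading components. -/
theorem exists_homogeneous_of_mul_mul_eq_zero {x y : G.LeavittPathAlgebra K} (hx : x ≠ 0)
    (hy : y ≠ 0) (h : ∀ a, x * a * y = 0) :
    ∃ c, ∃ x' ∈ degreePart K G c, x' ≠ 0 ∧ ∃ d, ∃ y' ∈ degreePart K G d, y' ≠ 0 ∧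
      ∀ a, x' * a * y' = 0 := by
  obtain ⟨f, hf, rfl⟩ := (Submodule.mem_iSup_iff_exists_finsupp _ _).mp
    ((iSup_degreePart K G).ge (Submodule.mem_top (x := x)))
  obtain ⟨g, hg, rfl⟩ := (Submodule.mem_iSup_iff_exists_finsupp _ _).mp
    ((iSup_degreePart K G).ge (Submodule.mem_top (x := y)))
  simp only [Finsupp.sum] at hx hy h
  have hfs : f.support.Nonempty := Finset.nonempty_of_sum_ne_zero hx
  have hgs : g.support.Nonempty := Finset.nonempty_of_sum_ne_zero hy
  set c := f.support.max' hfs with hc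
  set d := g.support.max' hgs with hd
  refine ⟨c, f c, hf c, Finsupp.mem_support_iff.mp (f.support.max'_mem hfs), d, g d, hg d,
    Finsupp.mem_support_iff.mp (g.support.max'_mem hgs), fun a => ?_⟩
  -- It suffices to treat the homogeneous components `q i` of `a`. The coefficient of the coaction
  -- of `x (q i) y` at `c + i + d` is the product of leading components `f c * q i * g d`: no other
  -- pair of exponents attains this maximal sum.
  obtain ⟨q, hq, rfl⟩ := (Submodule.mem_iSup_iff_exists_finsupp _ _).mp
    ((iSup_degreePart K G).ge (Submodule.mem_top (x := a)))
  rw [Finsupp.sum, Finset.mul_sum, Finset.sum_mul]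
  refine Finset.sum_eq_zero fun i _ => ?_
  have h0 := congrArg (coaction K G) (h (q i))
  rw [map_mul, map_mul, coaction_of_mem_degreePart (hq i), map_zero] at h0
  have hcx := coaction_coeff_of_sum hf
  have hcy := coaction_coeff_of_sum hg
  set X := coaction K G (∑ i ∈ f.support, f i)
  set Y := coaction K G (∑ i ∈ g.support, g i)
  have hX : ∀ n ∈ X.coeff.support, n ≤ c := fun n hn => Finset.le_max' _ _ (by
    rw [Finsupp.mem_support_iff, hcx] at hn
    exact Finsupp.mem_support_iff.mpr fun h => hn (by rw [h, Unitization.inr_zero]))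
  have hY : ∀ n ∈ Y.coeff.support, n ≤ d := fun n hn => Finset.le_max' _ _ (by
    rw [Finsupp.mem_support_iff, hcy] at hn
    exact Finsupp.mem_support_iff.mpr fun h => hn (by rw [h, Unitization.inr_zero]))
  have hZ : ∀ n, (X * monomial i (q i)).coeff (n + i) = X.coeff n * Unitization.inr (q i) :=
    fun n => AddMonoidAlgebra.coeff_mul_single_eq_coeff_mul _ fun m _ => add_left_inj i
  have hZ' : ∀ n ∈ (X * monomial i (q i)).coeff.support, n ≤ c + i := by
    intro n hn
    obtain ⟨m, rfl⟩ : ∃ m, n = m + i := ⟨n - i, by ring⟩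
    rw [Finsupp.mem_support_iff, hZ] at hn
    have := hX m (Finsupp.mem_support_iff.mpr fun h => hn (by rw [h, zero_mul]))
    omega
  have key := AddMonoidAlgebra.coeff_mul_add_of_uniqueAdd
    (f := X * monomial i (q i)) (g := Y) (a0 := c + i) (b0 := d) (by
      intro m n hm hn hmn
      have := hZ' m hm
      have := hY n hn
      omega)
  rw [h0, hZ, hcx, hcy, ← Unitization.inr_mul, ← Unitization.inr_mul] at key
  exact (Unitization.inr_injective (R := K) (by rw [← key]; rfl)).symm

end Grading

/-! ### Projections and reachability; primeness -/

section Prime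

variable {K : Type w} [Field K] {V : Type u} {E : Type v} {G : Ultragraph V E}

/-- Along an edge `e`, `t_e p_{s(e)} s_e = p_{r(e)}`, and `p_w` cuts this down to any `w ∈ r(e)`. -/
theorem exists_mul_mul_eq_p_of_reaches {v w : V} (h : G.Reaches v w) :
    ∃ a b, a * p K G (.singleton v) * b = p K G (.singleton w) := by
  refine h.induction (P := fun w => ∃ a b, a * p K G (.singleton v) * b = p K G (.singleton w))
    ?_ ⟨p K G (.singleton v), p K G (.singleton v), ?_⟩
  · rintro e ⟨a, b, hab⟩ w hw
    refine ⟨p K G (.singleton w) * t K G e * a, b * s K G e, ?_⟩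
    calc _ = p K G (.singleton w) * (t K G e * (a * p K G (.singleton v) * b) * s K G e) := by
          simp only [mul_assoc]
      _ = _ := by rw [hab, t_mul_p_source, t_mul_s_self, p_singleton_mul_p, if_pos hw]
  · rw [p_mul_p_of_subset _ _ subset_rfl, p_mul_p_of_subset _ _ subset_rfl]

theorem p_mul_mul_p_eq_zero {v w : V} (h : ¬ ∃ u, G.Reaches v u ∧ G.Reaches w u)
    (a : G.LeavittPathAlgebra K) : p K G (.singleton v) * a * p K G (.singleton w) = 0 := by
  have ha : a ∈ Submodule.span K {x | ∃ m j : ℕ, IsMonomial K G m j x} := by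
    rw [span_isMonomial]; trivial
  induction ha using Submodule.span_induction with
  | mem x hx =>
    obtain ⟨m, j, hx⟩ := hx
    by_contra hne
    obtain ⟨b, rfl, c, rfl, hu⟩ := hx.exists_reaches _ _ hne
    exact h hu
  | zero => rw [mul_zero, zero_mul]
  | add x y _ _ ihx ihy => rw [mul_add, add_mul, ihx, ihy, add_zero]
  | smul k x _ ih => rw [mul_smul_comm, smul_mul_assoc, ih, smul_zero]

end Prime

end LeavittPathAlgebra

end Ultragraph

/-- In a prime ring, `x y = 0` and `x R y = 0` only if `x` or `y` vanishes. -/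
theorem IsPrimeRing.eq_zero_or_eq_zero {R : Type u} [NonUnitalRing R] (hR : IsPrimeRing R) {x y : R}
    (hxy : x * y = 0) (h : ∀ a, x * a * y = 0) : x = 0 ∨ y = 0 := by
  -- `J` is the right annihilator of the right ideal generated by `x`, and `I` below is the left
  -- annihilator of `J`; both are two-sided, with `x ∈ I` and `y ∈ J`. In the absence of a unit, `x
  -- z = 0` must be imposed separately from `x R z = 0`.
  let J : TwoSidedIdeal R := TwoSidedIdeal.mk' {z | x * z = 0 ∧ ∀ a, x * a * z = 0}
    ⟨mul_zero _, fun a => mul_zero _⟩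
    (fun {z z'} hz hz' => ⟨by rw [mul_add, hz.1, hz'.1, add_zero],
      fun a => by rw [mul_add, hz.2, hz'.2, add_zero]⟩)
    (fun {z} hz => ⟨by rw [mul_neg, hz.1, neg_zero], fun a => by rw [mul_neg, hz.2, neg_zero]⟩)
    (fun {b z} hz => ⟨by rw [← mul_assoc, hz.2],
      fun a => by rw [← mul_assoc, mul_assoc x, hz.2]⟩)
    (fun {z b} hz => ⟨by rw [← mul_assoc, hz.1, zero_mul],
      fun a => by rw [← mul_assoc, hz.2, zero_mul]⟩)
  have hJ : ∀ z, z ∈ J ↔ x * z = 0 ∧ ∀ a, x * a * z = 0 := fun z => TwoSidedIdeal.mem_mk' ..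
  let I : TwoSidedIdeal R := TwoSidedIdeal.mk' {z | ∀ b ∈ J, z * b = 0}
    (fun b _ => zero_mul b)
    (fun {z z'} hz hz' b hb => by rw [add_mul, hz b hb, hz' b hb, add_zero])
    (fun {z} hz b hb => by rw [neg_mul, hz b hb, neg_zero])
    (fun {c z} hz b hb => by rw [mul_assoc, hz b hb, mul_zero])
    (fun {z c} hz b hb => by rw [mul_assoc, hz _ (J.mul_mem_left _ _ hb)])
  have hI : ∀ z, z ∈ I ↔ ∀ b ∈ J, z * b = 0 := fun z => TwoSidedIdeal.mem_mk' ..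
  have hx : x ∈ I := (hI x).mpr fun b hb => ((hJ b).mp hb).1
  have hy : y ∈ J := (hJ y).mpr ⟨hxy, h⟩
  rcases hR I J fun a ha b hb => (hI a).mp ha b hb with h0 | h0
  · left; rwa [h0, TwoSidedIdeal.mem_bot] at hx
  · right; rwa [h0, TwoSidedIdeal.mem_bot] at hy

open Ultragraph LeavittPathAlgebra in
theorem mainTheorem7 {V : Type u} {E : Type v} [Countable V] [Countable E]
    (G : Ultragraph V E) (K : Type w) [Field K] :
    IsPrimeRing (G.LeavittPathAlgebra K) ↔ G.DownwardDirected := by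
  have hp : ∀ v, p K G (.singleton v) ≠ 0 := fun v => p_ne_zero G K _ (Set.singleton_nonempty v)
  constructor
  · intro hR v w
    by_contra h
    have h0 := p_mul_mul_p_eq_zero (K := K) h
    have hvw := h0 (p K G (.singleton v))
    rw [p_mul_p_of_subset _ _ subset_rfl] at hvw
    exact (hR.eq_zero_or_eq_zero hvw h0).elim (hp v) (hp w)
  · intro hG I J hIJ
    by_contra! hne
    have hmem : ∀ I : TwoSidedIdeal (G.LeavittPathAlgebra K), I ≠ ⊥ → ∃ x ∈ I, x ≠ 0 := by
      intro I hI
      by_contra! h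
      exact hI (eq_bot_iff.mpr fun x hx => (TwoSidedIdeal.mem_bot _).mpr (h x hx))
    obtain ⟨x, hxI, hx⟩ := hmem I hne.1
    obtain ⟨y, hyJ, hy⟩ := hmem J hne.2
    obtain ⟨c, x, hxc, hx, d, y, hyd, hy, hxy⟩ := exists_homogeneous_of_mul_mul_eq_zero hx hy
      fun a => hIJ _ (I.mul_mem_right _ _ hxI) _ hyJ
    obtain ⟨M, hxM⟩ := exists_mem_degreePartLE hxc
    obtain ⟨N, hyN⟩ := exists_mem_degreePartLE hyd
    obtain ⟨a, b, v, hv⟩ := exists_mul_mul_eq_p M c hxM hx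
    obtain ⟨a', b', w, hw⟩ := exists_mul_mul_eq_p N d hyN hy
    obtain ⟨u, hvu, hwu⟩ := hG v w
    obtain ⟨q, r, hu⟩ := exists_mul_mul_eq_p_of_reaches (K := K) hvu
    obtain ⟨q', r', hu'⟩ := exists_mul_mul_eq_p_of_reaches (K := K) hwu
    refine hp u ?_
    calc p K G (.singleton u) = p K G (.singleton u) * p K G (.singleton u) :=
          (p_mul_p_of_subset _ _ subset_rfl).symm
      -- Here `p_u = q (a x b) r` through `v` and `p_u = q' (a' y b') r'` through `w`; between `x`
      -- and `y` stands a single element of the algebra.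
      _ = q * a * (x * (b * r * q' * a') * y) * b' * r' := by
          nth_rw 1 [← hu]
          rw [← hu', ← hv, ← hw]
          simp only [mul_assoc]
      _ = 0 := by rw [hxy, mul_zero, zero_mul, zero_mul]
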